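/- Let $n\in\mathbb N$, let $Y$ be any set of labels, let $U_n$ be the uniform distribution on $\{0,1\}^n$, and let $\mathrm{HD}$ be the Hamming distance. Consider a classification problem $(\{0,1\}^n,Y,U_n,\mathcal C,\mathcal H,\mathrm{HD})$, where $\mathcal C$ and $\mathcal H$ are arbitrary classes of functions $\{0,1\}^n\to Y$ (concepts and hypotheses). For $h\in\mathcal H$, $c\in\mathcal C$ and $r\in[0,\infty]$ put $$\mathsf{Risk}(h,c)=\Pr_{x\gets U_n}[h(x)\ne c(x)],\qquad \mathsf{Risk}^{\mathrm{ER}}_r(h,c)=\Pr_{x\gets U_n}\bigl[\exists x'\in\{0,1\}^n:\ \mathrm{HD}(x,x')\le r,\ h(x')\neq c(x')\bigr].$$ Let $h\in\mathcal H$ and $c\in\mathcal C$. 1. Suppose $\mu=\mathsf{Risk}(h,c)\in(0,\frac12]$. Then for every $\mu'\in[\frac12,1]$, $$\mathsf{Risk}^{\mathrm{ER}}_r(h,c)\ge\mu'\qquad\text{for } r=\sqrt{\frac{-n\ln\mu}{2}}+\sqrt{\frac{-n\ln(1-\mu')}{2}},$$ where $\ln 0=-\infty$, so that $r=\infty$ (no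 restriction on the number of changed bits) when $\mu'=1$. Moreover, $\mathsf{Risk}^{\mathrm{ER}}_{r'}(h,c)\ge\frac12$ for $r'=\sqrt{-n\ln(\mu)/2}$. 2. In particular, if $\mathsf{Risk}(h,c)\ge 0.01$, then $\mathsf{Risk}^{\mathrm{ER}}_{1.52\sqrt n}(h,c)\ge 0.5$ and $\mathsf{Risk}^{\mathrm{ER}}_{3.04\sqrt n}(h,c)\ge 0.99$. -/

import Mathlib

open scoped ENNReal

noncomputable section

/-- A classification problem with instances `X`, labels `Y`, a fixed instance distribution,
a class of concept functions and a class of hypotheses. The metric on the instances is the one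
carried by `X`. -/
structure ClassificationProblem (X Y : Type*) [MetricSpace X] where
  distribution : PMF X
  concepts : Set (X → Y)
  hypotheses : Set (X → Y)

namespace ClassificationProblem

variable {X Y : Type*} [MetricSpace X]

/-- The risk `Pr_{x ← D}[h x ≠ c x]`. -/
def risk (P : ClassificationProblem X Y) (h c : X → Y) : ℝ :=
  (P.distribution.toOuterMeasure {x | h x ≠ c x}).toReal

/-- The error-region risk under `r`-perturbation,
`Pr_{x ← D}[∃ x', d(x, x') ≤ r ∧ h x' ≠ c x']`. The radius `r` may be `∞`, in which case the
perturbation is unrestricted. -/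
def errorRegionRisk (P : ClassificationProblem X Y) (r : ℝ≥0∞) (h c : X → Y) : ℝ :=
  (P.distribution.toOuterMeasure {x | ∃ x', edist x x' ≤ r ∧ h x' ≠ c x'}).toReal

end ClassificationProblem

/-- The hypercube `{0,1}^n`; the metric of `Hamming` is the number of differing coordinates. -/
abbrev Hypercube (n : ℕ) : Type := Hamming (fun _ : Fin n => Bool)

/-- The classification problem `({0,1}^n, Y, U_n, C, H, HD)`: uniform distribution, concept class
`C`, hypothesis class `H`, Hamming distance. -/
def uniformHypercubeProblem (n : ℕ) {Y : Type*} (C H : Set (Hypercube n → Y)) :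
    ClassificationProblem (Hypercube n) Y where
  distribution := PMF.uniformOfFintype (Hypercube n)
  concepts := C
  hypotheses := H

/-- `√(-n ln p / 2)` for `0 < p ≤ 1`, and `∞` for `p = 0` (where `ln 0 = -∞`). -/
def bitBudget (n : ℕ) (p : ℝ) : ℝ≥0∞ :=
  if p = 0 then ∞ else ENNReal.ofReal (√(-(n * Real.log p) / 2))

end

/-! Let `A` be the region where `h` and `c` differ, of density `μ`. The error-region risk at radius
`r` is the density of the `⌊r⌋`-thickening of `A`, so both bounds are statements about blowing up
sets in the cube.

For the bound with `μ'`, concentration suffices. The distance to `A` is 1-Lipschitz. McDiarmid's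
lower tail, applied to `A` itself where the distance vanishes, bounds the mean by `√(-n ln μ / 2)`;
the upper tail then leaves at most a fraction `1 - μ'` of the cube beyond the second radius
(`one_sub_mul_two_pow_le_card_thicken_floor`).

The bound `1/2` at the first radius alone is sharper, because the mean of the distance need not be a
median. It rests on vertex isoperimetry (`ballProfile_le_card_thicken_one`): thickening enlarges a
set at least as much as a Hamming ball. Interpolating ball sizes linearly keeps Pascal's rule and
the symmetry of the binomials, so the half cube is the exact value at `(n + 1) / 2` for either
parity of `n`. It remains to bound a binomial tail with no constant lost (`lowerTail_le_of_exp_lt`).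
As the thickening radius is `k = ⌊r⌋`, the hypothesis on `μ` involves `(k + 1) ^ 2`, and this
rounding gain must be used in full. -/

/-! ### Interpolated sizes of Hamming balls -/

/-- The function that is `0` up to `0`, `1` from `1` on, and linear in between. -/
def unitRamp (x : ℝ) : ℝ := max 0 (min 1 x)

lemma unitRamp_mono : Monotone unitRamp := fun x y h => by
  unfold unitRamp; gcongr

lemma unitRamp_of_nonpos {x : ℝ} (h : x ≤ 0) : unitRamp x = 0 := by
  unfold unitRamp; rw [min_eq_right (by linarith), max_eq_left h]

lemma unitRamp_of_one_le {x : ℝ} (h : 1 ≤ x) : unitRamp x = 1 := by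
  unfold unitRamp; rw [min_eq_left h, max_eq_right zero_le_one]

lemma unitRamp_of_mem {x : ℝ} (h0 : 0 ≤ x) (h1 : x ≤ 1) : unitRamp x = x := by
  unfold unitRamp; rw [min_eq_right h1, max_eq_right h0]

lemma unitRamp_nonneg (x : ℝ) : 0 ≤ unitRamp x := le_max_left _ _

lemma unitRamp_le_one (x : ℝ) : unitRamp x ≤ 1 := max_le zero_le_one (min_le_left _ _)

lemma continuous_unitRamp : Continuous unitRamp := by
  unfold unitRamp; fun_prop

lemma unitRamp_add_unitRamp_one_sub (x : ℝ) : unitRamp x + unitRamp (1 - x) = 1 := by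
  rcases le_total x 0 with h | h
  · rw [unitRamp_of_nonpos h, unitRamp_of_one_le (by linarith)]; ring
  rcases le_total x 1 with h' | h'
  · rw [unitRamp_of_mem h h', unitRamp_of_mem (by linarith) (by linarith)]; ring
  · rw [unitRamp_of_one_le h', unitRamp_of_nonpos (by linarith)]; ring

/-- The piecewise linear interpolation of `i ↦ ∑ j < i, n.choose j`, the size of a Hamming ball
of radius `i - 1` in the `n`-cube. -/
def ballProfile (n : ℕ) (t : ℝ) : ℝ :=
  ∑ j ∈ Finset.range (n + 1), (n.choose j : ℝ) * unitRamp (t - j)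

lemma ballProfile_mono (n : ℕ) : Monotone (ballProfile n) := fun s t h =>
  Finset.sum_le_sum fun j _ =>
    mul_le_mul_of_nonneg_left (unitRamp_mono (by linarith)) (Nat.cast_nonneg _)

lemma ballProfile_nonneg (n : ℕ) (t : ℝ) : 0 ≤ ballProfile n t :=
  Finset.sum_nonneg fun _ _ => mul_nonneg (Nat.cast_nonneg _) (unitRamp_nonneg _)

lemma continuous_ballProfile (n : ℕ) : Continuous (ballProfile n) :=
  continuous_finsetSum _ fun _ _ =>
    continuous_const.mul (continuous_unitRamp.comp (continuous_id.sub continuous_const))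

lemma ballProfile_le (n : ℕ) (t : ℝ) : ballProfile n t ≤ 2 ^ n := by
  have h : ∑ j ∈ Finset.range (n + 1), (n.choose j : ℝ) = 2 ^ n := by
    exact_mod_cast Nat.sum_range_choose n
  rw [← h]
  exact Finset.sum_le_sum fun j _ =>
    mul_le_of_le_one_right (Nat.cast_nonneg _) (unitRamp_le_one _)

lemma ballProfile_zero (n : ℕ) : ballProfile n 0 = 0 :=
  Finset.sum_eq_zero fun _ _ => by
    rw [unitRamp_of_nonpos (by simp), mul_zero]

/-- Pascal's rule survives interpolation; this drives the inductions on dimension, where a ball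
splits into two slices with radii differing by one. -/
lemma ballProfile_succ (n : ℕ) (t : ℝ) :
    ballProfile (n + 1) t = ballProfile n t + ballProfile n (t - 1) := by
  have h1 : ballProfile n t
      = ∑ j ∈ Finset.range (n + 1), (n.choose (j + 1) : ℝ) * unitRamp (t - (j + 1 : ℕ))
        + unitRamp t := by
    have : ballProfile n t = ∑ j ∈ Finset.range (n + 2), (n.choose j : ℝ) * unitRamp (t - j) := by
      rw [Finset.sum_range_succ, Nat.choose_succ_self]; simp [ballProfile]
    rw [this, Finset.sum_range_succ']; simp
  rw [h1, ballProfile, Finset.sum_range_succ', ballProfile, add_right_comm,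
    ← Finset.sum_add_distrib]
  congr 1
  · refine Finset.sum_congr rfl fun j _ => ?_
    rw [Nat.choose_succ_succ]
    push_cast
    rw [show t - ((j : ℝ) + 1) = t - 1 - j by ring]
    ring
  · simp

lemma ballProfile_add_reflect (n : ℕ) :
    ∀ t : ℝ, ballProfile n t + ballProfile n (n + 1 - t) = 2 ^ n := by
  induction n with
  | zero => intro t; simpa [ballProfile] using unitRamp_add_unitRamp_one_sub t
  | succ n ih =>
    intro t
    have h1 := ih t
    have h2 := ih (t - 1)
    rw [ballProfile_succ, ballProfile_succ, pow_succ]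
    push_cast
    rw [show (n : ℝ) + 1 + 1 - t - 1 = n + 1 - t by ring,
      show (n : ℝ) + 1 + 1 - t = n + 1 - (t - 1) by ring]
    linarith

lemma ballProfile_half (n : ℕ) : 2 * ballProfile n ((n + 1) / 2) = 2 ^ n := by
  have h := ballProfile_add_reflect n ((n + 1) / 2)
  rw [show (n : ℝ) + 1 - (n + 1) / 2 = (n + 1) / 2 by ring] at h
  linarith

lemma exists_ballProfile_eq (n : ℕ) {a : ℝ} (h0 : 0 ≤ a) (h1 : a ≤ 2 ^ n) :
    ∃ s : ℝ, 0 ≤ s ∧ ballProfile n s = a := by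
  have htop : ballProfile n (n + 1) = 2 ^ n := by
    simpa [ballProfile_zero] using ballProfile_add_reflect n 0
  obtain ⟨s, hs, h⟩ := intermediate_value_Icc (a := (0 : ℝ)) (b := n + 1) (by positivity)
    (continuous_ballProfile n).continuousOn
    (show a ∈ Set.Icc (ballProfile n 0) (ballProfile n (n + 1)) by
      rw [ballProfile_zero, htop]; exact ⟨h0, h1⟩)
  exact ⟨s, hs.1, h⟩

lemma choose_mul_choose_succ_le (n : ℕ) {j k : ℕ} (h : j ≤ k) :
    n.choose j * n.choose (k + 1) ≤ n.choose (j + 1) * n.choose k := by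
  have h1 := Nat.choose_succ_right_eq n k
  have h2 := Nat.choose_succ_right_eq n j
  refine Nat.le_of_mul_le_mul_right (c := (k + 1) * (j + 1)) ?_ (by positivity)
  calc n.choose j * n.choose (k + 1) * ((k + 1) * (j + 1))
      = n.choose j * (n.choose (k + 1) * (k + 1)) * (j + 1) := by ring
    _ = n.choose j * n.choose k * ((n - k) * (j + 1)) := by rw [h1]; ring
    _ ≤ n.choose j * n.choose k * ((n - j) * (k + 1)) := by gcongr
    _ = (n.choose j * (n - j)) * n.choose k * (k + 1) := by ring
    _ = n.choose (j + 1) * n.choose k * ((k + 1) * (j + 1)) := by rw [← h2]; ring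

lemma ballProfile_sub (n : ℕ) (a b : ℝ) : ballProfile n b - ballProfile n a =
    ∑ j ∈ Finset.range (n + 1), (n.choose j : ℝ) * (unitRamp (b - j) - unitRamp (a - j)) := by
  simp only [ballProfile, ← Finset.sum_sub_distrib, mul_sub]

lemma ballProfile_add_one_sub (n : ℕ) (a b : ℝ) :
    ballProfile n (b + 1) - ballProfile n (a + 1) =
    ∑ j ∈ Finset.range (n + 1), (n.choose (j + 1) : ℝ) * (unitRamp (b - j) - unitRamp (a - j))
      + (unitRamp (b + 1) - unitRamp (a + 1)) := by
  rw [ballProfile_sub, Finset.sum_range_succ', Finset.sum_range_succ, Nat.choose_succ_self]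
  simp

/-- An interval carrying at least the mass of an interval to its right still does so after both
are shifted by one. -/
lemma ballProfile_shift_le (n : ℕ) {a b c d : ℝ} (hc : 0 ≤ c) (hab : a ≤ b) (hbc : b ≤ c)
    (hcd : c ≤ d) (h : ballProfile n d - ballProfile n c ≤ ballProfile n b - ballProfile n a) :
    ballProfile n (d + 1) - ballProfile n (c + 1)
      ≤ ballProfile n (b + 1) - ballProfile n (a + 1) := by
  set α : ℕ → ℝ := fun j => unitRamp (b - j) - unitRamp (a - j) with hα
  set β : ℕ → ℝ := fun j => unitRamp (d - j) - unitRamp (c - j) with hβ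
  have hα0 : ∀ j, 0 ≤ α j := fun j => sub_nonneg.2 (unitRamp_mono (by linarith))
  have hβ0 : ∀ j, 0 ≤ β j := fun j => sub_nonneg.2 (unitRamp_mono (by linarith))
  have hY : ballProfile n d - ballProfile n c
      = ∑ j ∈ Finset.range (n + 1), (n.choose j : ℝ) * β j := ballProfile_sub n c d
  have hX : ballProfile n b - ballProfile n a
      = ∑ j ∈ Finset.range (n + 1), (n.choose j : ℝ) * α j := ballProfile_sub n a b
  have hY' : ballProfile n (d + 1) - ballProfile n (c + 1)
      = ∑ j ∈ Finset.range (n + 1), (n.choose (j + 1) : ℝ) * β j := by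
    rw [ballProfile_add_one_sub, unitRamp_of_one_le (by linarith : 1 ≤ d + 1),
      unitRamp_of_one_le (by linarith : 1 ≤ c + 1)]
    simp [hβ]
  have hX' : ∑ j ∈ Finset.range (n + 1), (n.choose (j + 1) : ℝ) * α j
      ≤ ballProfile n (b + 1) - ballProfile n (a + 1) := by
    rw [ballProfile_add_one_sub]
    have := unitRamp_mono (by linarith : a + 1 ≤ b + 1)
    simp only [hα]; linarith
  rw [hX, hY] at h
  rw [hY']
  refine le_trans ?_ hX'
  set X := ∑ j ∈ Finset.range (n + 1), (n.choose j : ℝ) * α j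
  set Y := ∑ j ∈ Finset.range (n + 1), (n.choose j : ℝ) * β j with hYdef
  set X' := ∑ j ∈ Finset.range (n + 1), (n.choose (j + 1) : ℝ) * α j
  set Y' := ∑ j ∈ Finset.range (n + 1), (n.choose (j + 1) : ℝ) * β j
  have hY'0 : 0 ≤ Y' := Finset.sum_nonneg fun j _ => mul_nonneg (Nat.cast_nonneg _) (hβ0 j)
  have hX'0 : 0 ≤ X' := Finset.sum_nonneg fun j _ => mul_nonneg (Nat.cast_nonneg _) (hα0 j)
  have hY0 : 0 ≤ Y := Finset.sum_nonneg fun j _ => mul_nonneg (Nat.cast_nonneg _) (hβ0 j)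
  -- Shifting by one replaces `n.choose j` by `n.choose (j + 1)`. Log-concavity compares the double
  -- sums term by term for `j ≤ k`; for `j > k` the product `α j * β k` vanishes because the first
  -- interval lies to the left of the second.
  have hprod : X * Y' ≤ X' * Y := by
    simp only [X, Y', X', Y, Finset.sum_mul_sum]
    refine Finset.sum_le_sum fun j _ => Finset.sum_le_sum fun k _ => ?_
    rcases le_or_gt j k with hjk | hjk
    · have h1 : ((n.choose j : ℝ) * n.choose (k + 1)) ≤ n.choose (j + 1) * n.choose k := by
        exact_mod_cast choose_mul_choose_succ_le n hjk
      have := mul_le_mul_of_nonneg_right h1 (mul_nonneg (hα0 j) (hβ0 k))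
      linarith
    · have hjk' : (k : ℝ) + 1 ≤ j := by exact_mod_cast hjk
      rcases le_total b j with hb | hb
      · have : α j = 0 := by
          simp only [hα]
          rw [unitRamp_of_nonpos (by linarith), unitRamp_of_nonpos (by linarith), sub_zero]
        simp [this]
      · have : β k = 0 := by
          simp only [hβ]
          rw [unitRamp_of_one_le (by linarith), unitRamp_of_one_le (by linarith), sub_self]
        simp [this]
  rcases hY0.eq_or_lt with h0 | hpos
  · have hz : ∀ j ∈ Finset.range (n + 1), (n.choose j : ℝ) * β j = 0 :=
      (Finset.sum_eq_zero_iff_of_nonneg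
        fun j _ => mul_nonneg (Nat.cast_nonneg _) (hβ0 j)).1 h0.symm
    have : Y' = 0 := Finset.sum_eq_zero fun j hj => by
      have hc : (n.choose j : ℝ) ≠ 0 := by
        exact_mod_cast (Nat.choose_pos (Nat.lt_succ_iff.1 (Finset.mem_range.1 hj))).ne'
      rw [(mul_eq_zero.1 (hz j hj)).resolve_left hc, mul_zero]
    rw [this]; exact hX'0
  · have := mul_le_mul_of_nonneg_right h hY'0
    nlinarith

lemma ballProfile_nat (n i : ℕ) :
    ballProfile n i = ∑ j ∈ Finset.range i, (n.choose j : ℝ) := by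
  have hterm : ∀ j : ℕ, (n.choose j : ℝ) * unitRamp ((i : ℝ) - j)
      = if j < i then (n.choose j : ℝ) else 0 := fun j => by
    split_ifs with hj
    · have : (j : ℝ) + 1 ≤ i := by exact_mod_cast hj
      rw [unitRamp_of_one_le (by linarith), mul_one]
    · have : (i : ℝ) ≤ j := by exact_mod_cast not_lt.1 hj
      rw [unitRamp_of_nonpos (by linarith), mul_zero]
  unfold ballProfile
  simp only [hterm]
  rw [← Finset.sum_filter]
  refine Finset.sum_subset (fun j hj => by simp at hj ⊢; exact hj.2) fun j hj hj' => ?_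
  simp only [Finset.mem_filter, Finset.mem_range, not_and_or, not_lt] at hj hj'
  rw [Nat.choose_eq_zero_of_lt (by omega), Nat.cast_zero]

lemma two_mul_ballProfile_add_half (n i : ℕ) :
    2 * ballProfile n (i + 1 / 2) = ballProfile n i + ballProfile n (i + 1) := by
  unfold ballProfile
  rw [Finset.mul_sum, ← Finset.sum_add_distrib]
  refine Finset.sum_congr rfl fun j _ => ?_
  rcases lt_trichotomy i j with h | rfl | h
  · have : (i : ℝ) + 1 ≤ j := by exact_mod_cast h
    rw [unitRamp_of_nonpos (by linarith), unitRamp_of_nonpos (by linarith),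
      unitRamp_of_nonpos (by linarith)]
    ring
  · rw [unitRamp_of_mem (by linarith) (by linarith), unitRamp_of_nonpos (by linarith),
      unitRamp_of_one_le (by linarith)]
    ring
  · have : (j : ℝ) + 1 ≤ i := by exact_mod_cast h
    rw [unitRamp_of_one_le (by linarith), unitRamp_of_one_le (by linarith),
      unitRamp_of_one_le (by linarith)]
    ring

/-! ### Vertex isoperimetry -/

/-- The points of the cube within Hamming distance `k` of `A`. -/
def thicken {n : ℕ} (A : Finset (Fin n → Bool)) (k : ℕ) : Finset (Fin n → Bool) :=
  {x | ∃ y ∈ A, hammingDist x y ≤ k}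

lemma mem_thicken {n : ℕ} {A : Finset (Fin n → Bool)} {k : ℕ} {x : Fin n → Bool} :
    x ∈ thicken A k ↔ ∃ y ∈ A, hammingDist x y ≤ k := by
  simp [thicken]

lemma subset_thicken {n : ℕ} (A : Finset (Fin n → Bool)) (k : ℕ) : A ⊆ thicken A k :=
  fun x hx => mem_thicken.2 ⟨x, hx, by simp⟩

/-- The slice of `A` where the first coordinate is `b`. -/
def slice {n : ℕ} (A : Finset (Fin (n + 1) → Bool)) (b : Bool) : Finset (Fin n → Bool) :=
  {x | (Fin.cons b x : Fin (n + 1) → Bool) ∈ A}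

lemma mem_slice {n : ℕ} {A : Finset (Fin (n + 1) → Bool)} {b : Bool} {x : Fin n → Bool} :
    x ∈ slice A b ↔ (Fin.cons b x : Fin (n + 1) → Bool) ∈ A := by
  simp [slice]

lemma sum_cube_succ {n : ℕ} (f : (Fin (n + 1) → Bool) → ℝ) :
    ∑ x, f x = ∑ x : Fin n → Bool, f (Fin.cons false x) + ∑ x : Fin n → Bool, f (Fin.cons true x) := by
  rw [← (Fin.consEquiv fun _ : Fin (n + 1) => Bool).sum_comp, Fintype.sum_prod_type,
    Fintype.sum_bool, add_comm]
  rfl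

lemma card_eq_slice_add_slice {n : ℕ} (A : Finset (Fin (n + 1) → Bool)) (b : Bool) :
    (A.card : ℝ) = (slice A b).card + (slice A !b).card := by
  have key : ∀ {N : ℕ} (B : Finset (Fin N → Bool)), (B.card : ℝ) = ∑ x, if x ∈ B then (1 : ℝ) else 0 :=
    fun B => by simp
  have h := key A
  rw [sum_cube_succ] at h
  simp only [← mem_slice] at h
  rw [← key, ← key] at h
  cases b <;> simp [h, add_comm]

lemma hammingDist_cons {n : ℕ} (b c : Bool) (x y : Fin n → Bool) :
    hammingDist (Fin.cons b x : Fin (n + 1) → Bool) (Fin.cons c y)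
      = (if b = c then 0 else 1) + hammingDist x y := by
  simp only [hammingDist, Finset.card_filter, Fin.sum_univ_succ, Fin.cons_zero, Fin.cons_succ]
  split_ifs <;> simp_all

lemma thicken_slice_subset {n : ℕ} (A : Finset (Fin (n + 1) → Bool)) (b : Bool) :
    thicken (slice A b) 1 ⊆ slice (thicken A 1) b := fun x hx => by
  obtain ⟨y, hy, h⟩ := mem_thicken.1 hx
  exact mem_slice.2 (mem_thicken.2 ⟨_, mem_slice.1 hy, by rw [hammingDist_cons]; simpa using h⟩)

lemma slice_not_subset {n : ℕ} (A : Finset (Fin (n + 1) → Bool)) (b : Bool) :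
    slice A (!b) ⊆ slice (thicken A 1) b := fun x hx =>
  mem_slice.2 (mem_thicken.2 ⟨_, mem_slice.1 hx, by rw [hammingDist_cons]; simp⟩)

lemma card_le_two_pow {n : ℕ} (A : Finset (Fin n → Bool)) : (A.card : ℝ) ≤ 2 ^ n := by
  have := A.card_le_univ
  simp only [Fintype.card_fun, Fintype.card_fin, Fintype.card_bool] at this
  exact_mod_cast this

/-- Vertex isoperimetry in the cube, interpolated between Hamming balls. -/
lemma ballProfile_le_card_thicken_one {n : ℕ} : ∀ (A : Finset (Fin n → Bool)) (t : ℝ), A.Nonempty →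
    ballProfile n t ≤ A.card → ballProfile n (t + 1) ≤ (thicken A 1).card := by
  induction n with
  | zero =>
    intro A t hA _
    have h1 : (1 : ℝ) ≤ (thicken A 1).card := by
      exact_mod_cast Finset.card_pos.2 (hA.mono (subset_thicken A 1))
    exact (ballProfile_le 0 _).trans (by simpa using h1)
  | succ n ih =>
    intro A t hA hcard
    obtain ⟨b, hb⟩ : ∃ b, (slice A !b).card ≤ (slice A b).card := by
      rcases le_total (slice A false).card (slice A true).card with h | h
      exacts [⟨true, h⟩, ⟨false, h⟩]
    set A0 := slice A b with hA0
    set A1 := slice A !b with hA1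
    have hsum : (A.card : ℝ) = A0.card + A1.card := card_eq_slice_add_slice A b
    have hb' : (A1.card : ℝ) ≤ A0.card := by exact_mod_cast hb
    have hA0ne : A0.Nonempty := by
      rw [← Finset.card_pos]
      have : (0 : ℝ) < A.card := by exact_mod_cast hA.card_pos
      have : (0 : ℝ) < A0.card := by linarith
      exact_mod_cast this
    obtain ⟨s, hs0, hs⟩ := exists_ballProfile_eq n (Nat.cast_nonneg A0.card) (card_le_two_pow A0)
    obtain ⟨u, hu0, hu⟩ := exists_ballProfile_eq n (Nat.cast_nonneg A1.card) (card_le_two_pow A1)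
    have hT : ((thicken A 1).card : ℝ)
        = (slice (thicken A 1) b).card + (slice (thicken A 1) !b).card :=
      card_eq_slice_add_slice _ b
    have h0 : ballProfile n (s + 1) ≤ (slice (thicken A 1) b).card :=
      (ih A0 s hA0ne hs.le).trans (by exact_mod_cast Finset.card_le_card (thicken_slice_subset A b))
    have h1 : (A0.card : ℝ) ≤ (slice (thicken A 1) !b).card := by
      have := slice_not_subset A (!b)
      rw [Bool.not_not] at this
      exact_mod_cast Finset.card_le_card this
    rw [ballProfile_succ, hsum, ← hs, ← hu] at hcard
    rw [ballProfile_succ, hT, add_sub_cancel_right]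
    -- If the larger slice has at least profile `t`, its thickening and its copy in the other slice
    -- suffice. Otherwise the mass of `[s, t]` is at most that of `[t - 1, u]`, and shifting both
    -- intervals by one gives the bound.
    rcases le_or_gt (ballProfile n t) (ballProfile n s) with hst | hst
    · have : ballProfile n (t + 1) ≤ ballProfile n (s + 1) := by
        rcases le_total t s with h | h
        · exact ballProfile_mono n (by linarith)
        · have := ballProfile_shift_le n (a := s) (b := s) hs0 le_rfl le_rfl h (by linarith)
          linarith
      rw [hs] at hst
      linarith
    · have hst' : s < t := (ballProfile_mono n).reflect_lt hst
      have hu1 : ballProfile n (t - 1) < ballProfile n u := by linarith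
      have hA1ne : A1.Nonempty := by
        rw [← Finset.card_pos]
        have : (0 : ℝ) < A1.card := by
          rw [← hu]; exact (ballProfile_nonneg n _).trans_lt hu1
        exact_mod_cast this
      have h2 : ballProfile n (u + 1) ≤ (slice (thicken A 1) !b).card :=
        (ih A1 u hA1ne hu.le).trans
          (by exact_mod_cast Finset.card_le_card (thicken_slice_subset A !b))
      have htu : t - 1 < u := (ballProfile_mono n).reflect_lt hu1
      rcases le_total u s with hus | hsu
      · have := ballProfile_shift_le n hs0 htu.le hus hst'.le (by linarith)
        rw [sub_add_cancel] at this
        linarith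
      -- The profile is flat beyond `n + 1`, so equal sizes do not force `u = s`; here `s` replaces
      -- `u` as right endpoint.
      · have heq : ballProfile n u = ballProfile n s :=
          le_antisymm (by rw [hs, hu]; exact hb') (ballProfile_mono n hsu)
        have := ballProfile_shift_le n hs0 (by
            refine ((ballProfile_mono n).reflect_lt (?_ : ballProfile n (t - 1) < ballProfile n s)).le
            rw [← heq]; exact hu1) le_rfl hst'.le (by linarith)
        rw [sub_add_cancel] at this
        have := ballProfile_mono n (by linarith : s + 1 ≤ u + 1)
        linarith

lemma thicken_thicken_subset {n : ℕ} (A : Finset (Fin n → Bool)) (k : ℕ) :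
    thicken (thicken A k) 1 ⊆ thicken A (k + 1) := fun x hx => by
  obtain ⟨y, hy, h⟩ := mem_thicken.1 hx
  obtain ⟨z, hz, h'⟩ := mem_thicken.1 hy
  exact mem_thicken.2 ⟨z, hz, (hammingDist_triangle x y z).trans (by omega)⟩

lemma ballProfile_le_card_thicken {n : ℕ} (A : Finset (Fin n → Bool)) (t : ℝ) (hA : A.Nonempty)
    (h : ballProfile n t ≤ A.card) (k : ℕ) : ballProfile n (t + k) ≤ (thicken A k).card := by
  induction k with
  | zero =>
    rw [Nat.cast_zero, add_zero]
    exact h.trans (by exact_mod_cast Finset.card_le_card (subset_thicken A 0))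
  | succ k ih =>
    have := ballProfile_le_card_thicken_one _ _ (hA.mono (subset_thicken A k)) ih
    push_cast
    rw [← add_assoc]
    exact this.trans (by exact_mod_cast Finset.card_le_card (thicken_thicken_subset A k))

/-- A set at least as large as the ball whose `k`-thickening is half of the cube has a
`k`-thickening of at least half of the cube. The ball sizes of the even and the odd dimension
`2 m` and `2 m + 1` are both expressed through dimension `2 m + 1`. -/
lemma two_pow_le_two_mul_card_thicken {n m k : ℕ} (hn : n = 2 * m ∨ n = 2 * m + 1) (hk : k ≤ m)
    (A : Finset (Fin n → Bool)) (hA : A.Nonempty)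
    (h : 2 ^ n * ∑ j ∈ Finset.range (m + 1 - k), ((2 * m + 1).choose j : ℝ)
      ≤ 2 ^ (2 * m + 1) * A.card) :
    (2 : ℝ) ^ n ≤ 2 * (thicken A k).card := by
  have key : ballProfile n ((n + 1) / 2 - k) ≤ A.card := by
    rw [← ballProfile_nat] at h
    rcases hn with rfl | rfl
    -- In even dimension the centre is a half-integer. The interpolated value there averages two
    -- adjacent balls, which by Pascal's rule is half of a ball in dimension `2 m + 1`.
    · have h1 := two_mul_ballProfile_add_half (2 * m) (m - k)
      have h2 := ballProfile_succ (2 * m) (((m + 1 - k : ℕ)) : ℝ)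
      rw [Nat.cast_sub (by omega)] at h2 h
      rw [Nat.cast_sub (by omega)] at h1
      push_cast at h1 h2 h ⊢
      rw [show (m : ℝ) + 1 - k - 1 = m - k by ring, show (m : ℝ) + 1 - k = m - k + 1 by ring] at h2
      rw [show (m : ℝ) + 1 - k = m - k + 1 by ring, h2, pow_succ, mul_assoc] at h
      rw [show ((2 : ℝ) * m + 1) / 2 - k = m - k + 1 / 2 by ring]
      have := le_of_mul_le_mul_left h (by positivity)
      linarith
    · have := le_of_mul_le_mul_left h (by positivity)
      rw [Nat.cast_sub (by omega)] at this
      push_cast at this ⊢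
      rw [show ((2 : ℝ) * m + 1 + 1) / 2 - k = m + 1 - k by ring]
      exact this
  have h1 := ballProfile_le_card_thicken A _ hA key k
  rw [sub_add_cancel] at h1
  have h2 := ballProfile_half n
  linarith

/-! ### Binomial tails -/

/-- The number of points of weight at most `m - k` in the cube of dimension `2 m + 1`. -/
def lowerTail (m k : ℕ) : ℕ := ∑ j ∈ Finset.range (m + 1 - k), (2 * m + 1).choose j

lemma lowerTail_zero (m : ℕ) : lowerTail m 0 = 4 ^ m := Nat.sum_range_choose_halfway m

lemma lowerTail_pred (m : ℕ) : lowerTail (m + 1) m = 2 * (m + 1) + 2 := by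
  rw [lowerTail, show m + 1 + 1 - m = 2 by omega, Finset.sum_range_succ, Finset.sum_range_one]
  simp; ring

/-- Dropping the term `j = 0` of the larger sum aligns the two sums. Each ratio of consecutive
binomials is `(j + 1) / (2 m + 1 - j)`, at most its value at the top index `j = m - k - 1`. -/
lemma lowerTail_succ_mul_le {m k : ℕ} (hk : k < m) :
    lowerTail m (k + 1) * (m + k + 2) ≤ lowerTail m k * (m - k) := by
  rw [lowerTail, lowerTail, show m + 1 - k = (m + 1 - (k + 1)) + 1 by omega,
    Finset.sum_range_succ', add_mul, Finset.sum_mul, Finset.sum_mul]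
  refine le_add_right (Finset.sum_le_sum fun j hj => ?_)
  rw [Finset.mem_range] at hj
  have h := Nat.choose_succ_right_eq (2 * m + 1) j
  refine Nat.le_of_mul_le_mul_right (c := j + 1) ?_ (Nat.succ_pos j)
  calc (2 * m + 1).choose j * (m + k + 2) * (j + 1)
      ≤ (2 * m + 1).choose j * (2 * m + 1 - j) * (m - k) := by
        rw [mul_assoc, mul_assoc]
        exact Nat.mul_le_mul_left _ (Nat.mul_le_mul (by omega) (by omega))
    _ = (2 * m + 1).choose (j + 1) * (m - k) * (j + 1) := by rw [← h]; ring

/-- Two terms of the series of `2 artanh x`. The cubic term is needed for tails far from the centre.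
-/
lemma one_sub_div_one_add_le_exp {x : ℝ} (h0 : 0 ≤ x) (h1 : x < 1) :
    (1 - x) / (1 + x) ≤ Real.exp (-(2 * x + 2 / 3 * x ^ 3)) := by
  have h := Real.sum_range_le_log_div h0 h1 2
  rw [Finset.sum_range_succ, Finset.sum_range_one] at h
  norm_num at h
  have hpos : 0 < (1 + x) / (1 - x) := div_pos (by linarith) (by linarith)
  rw [Real.exp_neg, ← inv_div]
  refine inv_anti₀ (Real.exp_pos _) ?_
  rw [← Real.le_log_iff_exp_le hpos]
  linarith

/-- The probability that a uniform point of the cube of dimension `2 m + 1` has weight at most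
`m - k`. -/
noncomputable def lowerTailProb (m k : ℕ) : ℝ := lowerTail m k / 2 ^ (2 * m + 1)

lemma lowerTailProb_nonneg (m k : ℕ) : 0 ≤ lowerTailProb m k := by
  unfold lowerTailProb; positivity

lemma lowerTailProb_zero (m : ℕ) : lowerTailProb m 0 = 1 / 2 := by
  rw [lowerTailProb, lowerTail_zero, pow_succ, pow_mul]
  push_cast
  norm_num
  field_simp

lemma lowerTailProb_succ_le {m k : ℕ} (hk : k < m) :
    lowerTailProb m (k + 1) ≤ Real.exp (-(2 * ((k + 1) / (m + 1) : ℝ)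
      + 2 / 3 * ((k + 1) / (m + 1) : ℝ) ^ 3)) * lowerTailProb m k := by
  have hm : (0 : ℝ) < m + 1 := by positivity
  have hkm : (k : ℝ) + 1 ≤ m := by exact_mod_cast hk
  have h := one_sub_div_one_add_le_exp (x := (k + 1) / (m + 1)) (by positivity)
    (by rw [div_lt_one hm]; linarith)
  refine le_trans ?_ (mul_le_mul_of_nonneg_right h (lowerTailProb_nonneg m k))
  have h2 : ((lowerTail m (k + 1) * (m + k + 2) : ℕ) : ℝ) ≤ (lowerTail m k * (m - k) : ℕ) := by
    exact_mod_cast lowerTail_succ_mul_le hk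
  push_cast [Nat.cast_sub hk.le] at h2
  have h3 : (1 - ((k : ℝ) + 1) / (m + 1)) / (1 + (k + 1) / (m + 1)) = (m - k) / (m + k + 2) := by
    field_simp
    ring_nf
  rw [h3, lowerTailProb, lowerTailProb, div_mul_div_comm, div_le_div_iff₀ (by positivity) (by positivity)]
  nlinarith [pow_pos (two_pos : (0 : ℝ) < 2) (2 * m + 1)]

/-- The linear terms of the successive ratios add up to `k (k + 1) / (m + 1)`. -/
lemma lowerTailProb_le_half_mul_exp {m k : ℕ} (hk : k ≤ m) :
    lowerTailProb m k ≤ 1 / 2 * Real.exp (-(k * (k + 1) / (m + 1))) := by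
  induction k with
  | zero => simp [lowerTailProb_zero]
  | succ k ih =>
    have hm : (0 : ℝ) < m + 1 := by positivity
    calc lowerTailProb m (k + 1)
        ≤ Real.exp (-(2 * ((k + 1) / (m + 1) : ℝ) + 2 / 3 * ((k + 1) / (m + 1) : ℝ) ^ 3))
          * lowerTailProb m k := lowerTailProb_succ_le hk
      _ ≤ Real.exp (-(2 * ((k + 1) / (m + 1) : ℝ)))
          * (1 / 2 * Real.exp (-(k * (k + 1) / (m + 1)))) := by
        refine mul_le_mul (Real.exp_le_exp.2 ?_) (ih (by omega)) (lowerTailProb_nonneg m k)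
          (Real.exp_pos _).le
        have : (0 : ℝ) ≤ 2 / 3 * ((k + 1) / (m + 1) : ℝ) ^ 3 := by positivity
        linarith
      _ = 1 / 2 * Real.exp (-((k + 1 : ℕ) * ((k + 1 : ℕ) + 1) / (m + 1))) := by
        rw [mul_left_comm, ← Real.exp_add]
        congr 2
        push_cast
        field_simp
        ring

lemma lowerTailProb_le_exp_of_large {m k : ℕ} (hm : 36 ≤ m) (hk : k ≤ m) :
    lowerTailProb m k ≤ Real.exp (-((k + 1) ^ 2 / m)) := by
  have hm' : (36 : ℝ) ≤ m := by exact_mod_cast hm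
  have hm0 : (0 : ℝ) < m := by linarith
  induction k with
  | zero =>
    rw [lowerTailProb_zero]
    have := Real.add_one_le_exp (-(((0 : ℕ) + 1 : ℝ) ^ 2 / m))
    have h2 : (1 : ℝ) / m ≤ 1 / 36 := one_div_le_one_div_of_le (by norm_num) hm'
    norm_num at this h2 ⊢
    linarith
  | succ j ih =>
    -- Up to `0.44 (m + 1)` the factor `1/2` pays for passing to the exponent `(k + 1) ^ 2 / m`, at
    -- a cost below `log 2`. Beyond it, the cubic term pays for each further step, as `(2 x + 1) /
    -- 36 ≤ 2 / 3 * x ^ 3` from `x = 0.44` on.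
    rcases le_or_gt (((j + 1 : ℕ) : ℝ)) (0.44 * (m + 1)) with h | h
    · refine (lowerTailProb_le_half_mul_exp hk).trans ?_
      set k : ℝ := ((j + 1 : ℕ) : ℝ) with hkdef
      have hk0 : 0 ≤ k := Nat.cast_nonneg _
      have hhalf : (1 / 2 : ℝ) = Real.exp (-Real.log 2) := by
        rw [Real.exp_neg, Real.exp_log two_pos]; norm_num
      rw [hhalf, ← Real.exp_add, Real.exp_le_exp]
      have hlog := Real.log_two_gt_d9
      have hkey : (k + 1) * (k + 1 + m) ≤ 0.6931 * (m * (m + 1)) := by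
        calc (k + 1) * (k + 1 + m) ≤ (0.44 * (m + 1) + 1) * (0.44 * (m + 1) + 1 + m) := by gcongr
          _ ≤ 0.6931 * (m * (m + 1)) := by nlinarith
      have : (k + 1) ^ 2 / m = k * (k + 1) / (m + 1) + (k + 1) * (k + 1 + m) / (m * (m + 1)) := by
        field_simp
        ring
      have h4 : (k + 1) * (k + 1 + m) / (m * (m + 1)) ≤ 0.6931 :=
        (div_le_iff₀ (by positivity)).2 hkey
      rw [this]
      linarith
    · refine (lowerTailProb_succ_le hk).trans ?_
      refine (mul_le_mul_of_nonneg_left (ih (by omega)) (Real.exp_pos _).le).trans ?_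
      rw [← Real.exp_add, Real.exp_le_exp]
      push_cast at h ⊢
      obtain ⟨x, hx⟩ : ∃ x : ℝ, x = ((j : ℝ) + 1) / (m + 1) := ⟨_, rfl⟩
      have hx1 : 0.44 ≤ x := by rw [hx, le_div_iff₀ (by positivity)]; exact h.le
      have hj : (j : ℝ) = x * (m + 1) - 1 := by rw [hx]; field_simp; ring
      rw [← hx]
      have hexp : ((j : ℝ) + 1 + 1) ^ 2 / m = (j + 1) ^ 2 / m + (2 * x + (2 * x + 1) / m) := by
        rw [hj]; field_simp; ring
      have hsmall : (2 * x + 1) / m ≤ (2 * x + 1) / 36 := by gcongr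
      have hcube : (2 * x + 1) / 36 ≤ 2 / 3 * x ^ 3 := by
        nlinarith [mul_nonneg (sub_nonneg.2 hx1) (sub_nonneg.2 hx1), mul_nonneg (sub_nonneg.2 hx1) (mul_self_nonneg x)]
      rw [hexp]
      linarith

/-- The partial sums of a row of binomial coefficients, in a form that evaluates fast. -/
def choosePartialSum (N : ℕ) : ℕ → ℕ
  | 0 => 0
  | i + 1 => choosePartialSum N i + N.descFactorial i / i.factorial

lemma choosePartialSum_eq (N i : ℕ) :
    choosePartialSum N i = ∑ j ∈ Finset.range i, N.choose j := by
  induction i with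
  | zero => rfl
  | succ i ih =>
    rw [choosePartialSum, ih, Finset.sum_range_succ, Nat.choose_eq_descFactorial_div_factorial]

-- The finitely many small cases: the tail bound raised to the power `m`, with `e` replaced by the
-- upper bound `2.7183`. The index `k = m - 1` is left out since the bound fails there for `m = 1`
-- and `m = 2`.
set_option maxRecDepth 100000 in
lemma choosePartialSum_pow_le : ∀ m < 36, ∀ k < m - 1,
    choosePartialSum (2 * m + 1) (m + 1 - k) ^ m * 27183 ^ (k + 1) ^ 2
      ≤ 2 ^ ((2 * m + 1) * m) * 10000 ^ (k + 1) ^ 2 := by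
  decide +kernel

lemma lowerTailProb_le_exp {m k : ℕ} (hk : k + 2 ≤ m) :
    lowerTailProb m k ≤ Real.exp (-((k + 1) ^ 2 / m)) := by
  rcases le_or_gt 36 m with h | h
  · exact lowerTailProb_le_exp_of_large h (by omega)
  have hnat := choosePartialSum_pow_le m h k (by omega)
  rw [choosePartialSum_eq] at hnat
  change lowerTail m k ^ m * _ ≤ _ at hnat
  have hreal : (lowerTail m k : ℝ) ^ m * 27183 ^ (k + 1) ^ 2
      ≤ 2 ^ ((2 * m + 1) * m) * 10000 ^ (k + 1) ^ 2 := by exact_mod_cast hnat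
  have hm0 : m ≠ 0 := by omega
  have hmR : (m : ℝ) ≠ 0 := by exact_mod_cast hm0
  refine le_of_pow_le_pow_left₀ hm0 (Real.exp_pos _).le ?_
  have hexp : Real.exp (-(((k : ℝ) + 1) ^ 2 / m)) ^ m = (Real.exp 1 ^ (k + 1) ^ 2)⁻¹ := by
    rw [← Real.exp_nat_mul, ← Real.exp_nat_mul, ← Real.exp_neg]
    congr 1
    push_cast
    field_simp
  have he : Real.exp 1 ^ (k + 1) ^ 2 ≤ (27183 / 10000 : ℝ) ^ (k + 1) ^ 2 :=
    pow_le_pow_left₀ (Real.exp_pos _).le (by linarith [Real.exp_one_lt_d9]) _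
  rw [hexp]
  refine le_trans ?_ (inv_anti₀ (pow_pos (Real.exp_pos _) _) he)
  rw [lowerTailProb, div_pow, ← pow_mul, div_pow, inv_div]
  rw [div_le_div_iff₀ (by positivity) (by positivity)]
  linarith

/-- Serves the extreme index `k = m - 1` in even dimension; since `e < 3`, the induction step works
from `m = 3` on. -/
lemma mul_exp_le_four_pow (m : ℕ) : m * Real.exp m ≤ 4 ^ m := by
  have he := Real.exp_one_lt_d9
  have key : ∀ m : ℕ, (m + 3 : ℕ) * Real.exp 1 ^ (m + 3) ≤ 4 ^ (m + 3) := fun m => by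
    induction m with
    | zero =>
      have : Real.exp 1 ^ 3 ≤ 2.7183 ^ 3 :=
        pow_le_pow_left₀ (Real.exp_pos _).le (by linarith) 3
      norm_num at this ⊢
      linarith
    | succ m ih =>
      have h1 : ((m + 1 + 3 : ℕ) : ℝ) * Real.exp 1 ≤ 4 * (m + 3 : ℕ) := by
        push_cast
        nlinarith [Nat.cast_nonneg (α := ℝ) m]
      calc ((m + 1 + 3 : ℕ) : ℝ) * Real.exp 1 ^ (m + 1 + 3)
          = ((m + 1 + 3 : ℕ) * Real.exp 1) * Real.exp 1 ^ (m + 3) := by ring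
        _ ≤ (4 * (m + 3 : ℕ)) * Real.exp 1 ^ (m + 3) := by gcongr
        _ = 4 * ((m + 3 : ℕ) * Real.exp 1 ^ (m + 3)) := by ring
        _ ≤ 4 * 4 ^ (m + 3) := by gcongr
        _ = 4 ^ (m + 1 + 3) := by ring
  rw [← mul_one (m : ℝ), Real.exp_nat_mul, mul_one]
  rcases m with _ | _ | _ | m
  · simp
  · norm_num; linarith
  · have : Real.exp 1 ^ 2 ≤ 2.7183 ^ 2 := pow_le_pow_left₀ (Real.exp_pos _).le (by linarith) 2
    norm_num at this ⊢
    linarith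
  · exact key m

/-- Serves `k = m - 1` in odd dimension. The ratio of the two sides is largest at `m = 2`, and
`1.3875` lies just above `3 e ^ 2 / 16` and below `exp (1 / 3)`. -/
lemma succ_mul_exp_le_four_pow {m : ℕ} (hm : 1 ≤ m) :
    (m + 1) * Real.exp m ≤ 1.3875 * 4 ^ m := by
  have he := Real.exp_one_lt_d9
  have key : ∀ m : ℕ, ((m + 2 : ℕ) + 1) * Real.exp 1 ^ (m + 2) ≤ 1.3875 * 4 ^ (m + 2) := fun m => by
    induction m with
    | zero =>
      have : Real.exp 1 ^ 2 ≤ 2.7183 ^ 2 :=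
        pow_le_pow_left₀ (Real.exp_pos _).le (by linarith) 2
      norm_num at this ⊢
      linarith
    | succ m ih =>
      have h1 : (((m + 1 + 2 : ℕ) : ℝ) + 1) * Real.exp 1 ≤ 4 * ((m + 2 : ℕ) + 1) := by
        push_cast
        nlinarith [Nat.cast_nonneg (α := ℝ) m]
      calc (((m + 1 + 2 : ℕ) : ℝ) + 1) * Real.exp 1 ^ (m + 1 + 2)
          = (((m + 1 + 2 : ℕ) + 1) * Real.exp 1) * Real.exp 1 ^ (m + 2) := by ring
        _ ≤ (4 * ((m + 2 : ℕ) + 1)) * Real.exp 1 ^ (m + 2) := by gcongr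
        _ = 4 * (((m + 2 : ℕ) + 1) * Real.exp 1 ^ (m + 2)) := by ring
        _ ≤ 4 * (1.3875 * 4 ^ (m + 2)) := by gcongr
        _ = 1.3875 * 4 ^ (m + 1 + 2) := by ring
  rw [← mul_one (m : ℝ), Real.exp_nat_mul, mul_one]
  rcases m with _ | _ | m
  · omega
  · norm_num; linarith
  · exact key m

lemma thicken_mono {n : ℕ} (A : Finset (Fin n → Bool)) {k l : ℕ} (h : k ≤ l) :
    thicken A k ⊆ thicken A l := fun x hx => by
  obtain ⟨y, hy, hxy⟩ := mem_thicken.1 hx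
  exact mem_thicken.2 ⟨y, hy, hxy.trans h⟩

lemma lowerTail_le_of_exp_lt {n m k a : ℕ} (hn : n = 2 * m ∨ n = 2 * m + 1) (hm : 0 < m)
    (hk : k < m) (h : Real.exp (-(2 * (k + 1) ^ 2 / n)) * 2 ^ n < a) :
    (2 : ℝ) ^ n * lowerTail m k ≤ 2 ^ (2 * m + 1) * a := by
  have hmR : (0 : ℝ) < m := by exact_mod_cast hm
  have hnm : (2 * m : ℝ) ≤ n := by rcases hn with rfl | rfl <;> push_cast <;> linarith
  rcases Nat.lt_or_ge (k + 1) m with hk2 | hk1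
  · have h1 := lowerTailProb_le_exp (m := m) (k := k) (by omega)
    have h2 : Real.exp (-(((k : ℝ) + 1) ^ 2 / m)) ≤ Real.exp (-(2 * (k + 1) ^ 2 / n)) := by
      rw [Real.exp_le_exp, neg_le_neg_iff, div_le_div_iff₀ (by linarith) hmR]
      nlinarith [sq_nonneg ((k : ℝ) + 1)]
    have h3 := h1.trans h2
    rw [lowerTailProb, div_le_iff₀ (by positivity)] at h3
    calc (2 : ℝ) ^ n * lowerTail m k
        ≤ 2 ^ n * (Real.exp (-(2 * (k + 1) ^ 2 / n)) * 2 ^ (2 * m + 1)) := by gcongr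
      _ = 2 ^ (2 * m + 1) * (Real.exp (-(2 * (k + 1) ^ 2 / n)) * 2 ^ n) := by ring
      _ ≤ 2 ^ (2 * m + 1) * a := by gcongr
  · obtain rfl : m = k + 1 := by omega
    rw [lowerTail_pred]
    rcases hn with rfl | rfl
    -- The exponential bound only yields `m < a`; integrality of `a` supplies the missing unit.
    · have hlt : ((k + 1 : ℕ) : ℝ) < a := by
        refine lt_of_le_of_lt ?_ h
        have he : -(2 * ((k : ℝ) + 1) ^ 2 / (2 * (k + 1) : ℕ)) = -((k + 1 : ℕ) : ℝ) := by
          push_cast; field_simp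
        rw [he, Real.exp_neg, inv_mul_eq_div, le_div_iff₀ (Real.exp_pos _), pow_mul]
        norm_num only [mul_exp_le_four_pow (k + 1)]
      have hle : ((k + 1 : ℕ) : ℝ) + 1 ≤ a := by exact_mod_cast hlt
      rw [pow_succ]
      push_cast at hle ⊢
      nlinarith [pow_pos (two_pos : (0 : ℝ) < 2) (2 * (k + 1))]
    · refine mul_le_mul_of_nonneg_left ?_ (by positivity)
      refine le_trans ?_ h.le
      have hthird : (1.3875 : ℝ) ≤ Real.exp (1 / 3) := by
        refine le_of_pow_le_pow_left₀ (three_ne_zero) (Real.exp_pos _).le ?_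
        rw [← Real.exp_nat_mul]
        norm_num
        linarith [Real.exp_one_gt_d9]
      -- In odd dimension the exponent is `2 m ^ 2 / (2 m + 1) ≤ m - 1 / 3`, with equality at `m =
      -- 1`; the gained `exp (1 / 3)` absorbs `1.3875`.
      have he : -((k + 1 : ℕ) : ℝ) + 1 / 3 ≤ -(2 * ((k : ℝ) + 1) ^ 2 / (2 * (k + 1) + 1 : ℕ)) := by
        rw [le_neg, div_le_iff₀ (by positivity)]
        push_cast
        nlinarith [Nat.cast_nonneg (α := ℝ) k]
      have h1 : Real.exp (-((k + 1 : ℕ) : ℝ)) * 1.3875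
          ≤ Real.exp (-(2 * ((k : ℝ) + 1) ^ 2 / (2 * (k + 1) + 1 : ℕ))) := by
        refine le_trans ?_ (Real.exp_le_exp.2 he)
        rw [Real.exp_add]
        gcongr
      have h2 := succ_mul_exp_le_four_pow (m := k + 1) (by omega)
      have h3 : ((k + 1 : ℕ) : ℝ) + 1 ≤ Real.exp (-((k + 1 : ℕ) : ℝ)) * 1.3875 * 4 ^ (k + 1) := by
        rw [Real.exp_neg, mul_assoc, inv_mul_eq_div, le_div_iff₀ (Real.exp_pos _)]
        exact h2
      calc ((2 * (k + 1) + 2 : ℕ) : ℝ) = 2 * (((k + 1 : ℕ) : ℝ) + 1) := by push_cast; ring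
        _ ≤ 2 * (Real.exp (-((k + 1 : ℕ) : ℝ)) * 1.3875 * 4 ^ (k + 1)) := by gcongr
        _ = Real.exp (-((k + 1 : ℕ) : ℝ)) * 1.3875 * 2 ^ (2 * (k + 1) + 1) := by
          rw [pow_succ 2, pow_mul]; norm_num; ring
        _ ≤ _ := by gcongr

/-! ### Thickening up to half of the cube -/

/-- The radius `√(-n ln p / 2)`. -/
noncomputable def tailRadius (n : ℕ) (p : ℝ) : ℝ := √(-(n * Real.log p) / 2)

lemma tailRadius_nonneg (n : ℕ) (p : ℝ) : 0 ≤ tailRadius n p := Real.sqrt_nonneg _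

/-- Thickening a set of density `μ` by `√(-n ln μ / 2)` covers at least half of the cube. -/
lemma two_pow_le_two_mul_card_thicken_floor {n : ℕ} (hn : 0 < n) (A : Finset (Fin n → Bool))
    (hA : A.Nonempty) {r : ℝ} (hr : tailRadius n (A.card / 2 ^ n) ≤ r) :
    (2 : ℝ) ^ n ≤ 2 * (thicken A ⌊r⌋₊).card := by
  set k := ⌊r⌋₊ with hk
  have hn2 : n = 2 * (n / 2) ∨ n = 2 * (n / 2) + 1 := by omega
  have hA1 : (1 : ℝ) ≤ A.card := by exact_mod_cast hA.card_pos
  rcases Nat.lt_or_ge k (n / 2) with hkm | hkm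
  · refine two_pow_le_two_mul_card_thicken hn2 hkm.le A hA ?_
    have hnR : (0 : ℝ) < n := by exact_mod_cast hn
    have h1 : tailRadius n (A.card / 2 ^ n) < k + 1 := hr.trans_lt (Nat.lt_floor_add_one r)
    rw [tailRadius, Real.sqrt_lt' (by positivity)] at h1
    have h2 : -(2 * ((k : ℝ) + 1) ^ 2 / n) < Real.log (A.card / 2 ^ n) := by
      rw [neg_lt, lt_div_iff₀ hnR]
      linarith
    rw [Real.lt_log_iff_exp_lt (by positivity), lt_div_iff₀ (by positivity)] at h2
    have := lowerTail_le_of_exp_lt hn2 (by omega) hkm h2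
    simpa [lowerTail] using this
  -- At radius `n / 2` a single point already suffices: the tail sum reduces to the one term `1`.
  · have h1 := two_pow_le_two_mul_card_thicken hn2 le_rfl A hA (by
      have : (2 : ℝ) ^ n ≤ 2 ^ (2 * (n / 2) + 1) := by
        gcongr
        · norm_num
        · omega
      simp
      nlinarith [pow_pos (two_pos : (0 : ℝ) < 2) (2 * (n / 2) + 1)])
    refine h1.trans ?_
    gcongr
    exact thicken_mono A hkm

/-! ### Concentration of Lipschitz functions -/

lemma exp_add_exp_le {a b : ℝ} {l : ℝ} (h : |a - b| ≤ 1) :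
    Real.exp (l * a) + Real.exp (l * b) ≤ 2 * Real.exp (l * ((a + b) / 2) + l ^ 2 / 8) := by
  have hc := Real.cosh_le_exp_half_sq (l * ((a - b) / 2))
  have h1 : Real.exp (l * a) + Real.exp (l * b)
      = 2 * (Real.exp (l * ((a + b) / 2)) * Real.cosh (l * ((a - b) / 2))) := by
    rw [Real.cosh_eq, mul_div_assoc', mul_add, ← Real.exp_add, ← Real.exp_add,
      mul_div_cancel₀ _ two_ne_zero]
    congr 2 <;> ring
  rw [h1, Real.exp_add]
  gcongr
  refine hc.trans (Real.exp_le_exp.2 ?_)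
  have : (a - b) ^ 2 ≤ 1 := (sq_le_one_iff_abs_le_one _).2 h
  nlinarith [mul_le_mul_of_nonneg_left this (sq_nonneg l)]

/-- The average over the cube. -/
noncomputable def cubeAverage {n : ℕ} (f : (Fin n → Bool) → ℝ) : ℝ := (∑ x, f x) / 2 ^ n

lemma cubeAverage_succ {n : ℕ} (f : (Fin (n + 1) → Bool) → ℝ) :
    cubeAverage f = (cubeAverage (fun x : Fin n → Bool => f (Fin.cons false x))
      + cubeAverage (fun x : Fin n → Bool => f (Fin.cons true x))) / 2 := by
  rw [cubeAverage, cubeAverage, cubeAverage, sum_cube_succ, ← add_div, div_div, pow_succ]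

/-- Hoeffding's argument one coordinate at a time: the averages over the two slices differ by at
most one, so each coordinate contributes `l ^ 2 / 8`. -/
lemma sum_exp_le_of_lipschitz {n : ℕ} (l : ℝ) : ∀ (f : (Fin n → Bool) → ℝ),
    (∀ x y, |f x - f y| ≤ hammingDist x y) →
    ∑ x, Real.exp (l * f x) ≤ 2 ^ n * Real.exp (l * cubeAverage f + n * l ^ 2 / 8) := by
  induction n with
  | zero => intro f _; simp [cubeAverage]
  | succ n ih =>
    intro f hf
    have hlip : ∀ b : Bool, ∀ x y : Fin n → Bool,
        |f (Fin.cons b x) - f (Fin.cons b y)| ≤ hammingDist x y := fun b x y => by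
      simpa [hammingDist_cons] using hf (Fin.cons b x) (Fin.cons b y)
    have h0 := ih _ (hlip false)
    have h1 := ih _ (hlip true)
    have havg : |cubeAverage (fun x : Fin n → Bool => f (Fin.cons false x))
        - cubeAverage (fun x : Fin n → Bool => f (Fin.cons true x))| ≤ 1 := by
      rw [cubeAverage, cubeAverage, ← sub_div, ← Finset.sum_sub_distrib, abs_div,
        abs_of_pos (by positivity : (0 : ℝ) < 2 ^ n), div_le_one (by positivity)]
      refine (Finset.abs_sum_le_sum_abs _ _).trans ?_
      refine (Finset.sum_le_sum fun x _ => (?_ : _ ≤ (1 : ℝ))).trans (by simp)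
      simpa [hammingDist_cons] using hf (Fin.cons false x) (Fin.cons true x)
    have h2 := exp_add_exp_le (l := l) havg
    rw [sum_cube_succ, cubeAverage_succ]
    refine (add_le_add h0 h1).trans ?_
    rw [Real.exp_add, Real.exp_add, ← mul_add, ← add_mul]
    refine (mul_le_mul_of_nonneg_left (mul_le_mul_of_nonneg_right h2 (Real.exp_pos _).le)
      (by positivity)).trans_eq ?_
    rw [mul_assoc 2, ← Real.exp_add, pow_succ, ← mul_assoc]
    congr 2
    push_cast
    ring

/-- McDiarmid's inequality for the uniform distribution on the cube. -/
lemma card_le_of_lipschitz {n : ℕ} (hn : 0 < n) (f : (Fin n → Bool) → ℝ)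
    (hf : ∀ x y, |f x - f y| ≤ hammingDist x y) {t : ℝ} (ht : 0 ≤ t)
    (S : Finset (Fin n → Bool)) (hS : ∀ x ∈ S, cubeAverage f + t ≤ f x) :
    (S.card : ℝ) ≤ 2 ^ n * Real.exp (-(2 * t ^ 2 / n)) := by
  have hnR : (0 : ℝ) < n := by exact_mod_cast hn
  -- Minimises the Chernoff exponent `-l t + n l ^ 2 / 8`.
  set l : ℝ := 4 * t / n with hl
  have hl0 : 0 ≤ l := by positivity
  have h1 : S.card * Real.exp (l * (cubeAverage f + t)) ≤ ∑ x, Real.exp (l * f x) := by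
    rw [← nsmul_eq_mul]
    refine (Finset.card_nsmul_le_sum S _ _ fun x hx => ?_).trans
      (Finset.sum_le_univ_sum_of_nonneg fun x => (Real.exp_pos _).le)
    exact Real.exp_le_exp.2 (mul_le_mul_of_nonneg_left (hS x hx) hl0)
  have h2 := h1.trans (sum_exp_le_of_lipschitz l f hf)
  rw [← le_div_iff₀ (Real.exp_pos _), mul_div_assoc, ← Real.exp_sub] at h2
  refine h2.trans_eq ?_
  congr 2
  rw [hl]
  field_simp
  ring

/-- The Hamming distance to a nonempty set. -/
def distTo {n : ℕ} (A : Finset (Fin n → Bool)) (hA : A.Nonempty) (x : Fin n → Bool) : ℕ :=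
  A.inf' hA (hammingDist x)

lemma distTo_le_iff {n : ℕ} {A : Finset (Fin n → Bool)} {hA : A.Nonempty} {x : Fin n → Bool}
    {k : ℕ} : distTo A hA x ≤ k ↔ x ∈ thicken A k := by
  rw [distTo, Finset.inf'_le_iff, mem_thicken]

lemma distTo_le_add {n : ℕ} (A : Finset (Fin n → Bool)) (hA : A.Nonempty) (x y : Fin n → Bool) :
    distTo A hA x ≤ hammingDist x y + distTo A hA y := by
  obtain ⟨z, hz, h⟩ := mem_thicken.1 (distTo_le_iff.1 (le_refl (distTo A hA y)))
  exact distTo_le_iff.2 (mem_thicken.2 ⟨z, hz, (hammingDist_triangle x y z).trans (by omega)⟩)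

lemma abs_distTo_sub_le {n : ℕ} (A : Finset (Fin n → Bool)) (hA : A.Nonempty)
    (x y : Fin n → Bool) : |(distTo A hA x : ℝ) - distTo A hA y| ≤ hammingDist x y := by
  have h1 : (distTo A hA x : ℝ) ≤ hammingDist x y + distTo A hA y := by
    exact_mod_cast distTo_le_add A hA x y
  have h2 : (distTo A hA y : ℝ) ≤ hammingDist x y + distTo A hA x := by
    rw [hammingDist_comm]; exact_mod_cast distTo_le_add A hA y x
  rw [abs_le]
  constructor <;> linarith

lemma cubeAverage_distTo_le {n : ℕ} (hn : 0 < n) (A : Finset (Fin n → Bool)) (hA : A.Nonempty) :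
    cubeAverage (fun x => (distTo A hA x : ℝ)) ≤ tailRadius n (A.card / 2 ^ n) := by
  have hnR : (0 : ℝ) < n := by exact_mod_cast hn
  have hA1 : (0 : ℝ) < A.card := by exact_mod_cast hA.card_pos
  set e := cubeAverage (fun x => (distTo A hA x : ℝ)) with he
  have he0 : 0 ≤ e := by unfold e cubeAverage; positivity
  have hneg : cubeAverage (fun x => -(distTo A hA x : ℝ)) = -e := by
    rw [he, cubeAverage, cubeAverage, Finset.sum_neg_distrib, neg_div]
  -- Minus the distance exceeds its mean `-e` by exactly `e` on all of `A`, so the density of `A` is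
  -- at most `exp (-2 e ^ 2 / n)`.
  have h := card_le_of_lipschitz hn (fun x => -(distTo A hA x : ℝ))
    (fun x y => by
      have := abs_distTo_sub_le A hA y x
      rw [hammingDist_comm] at this
      convert this using 2
      ring) he0 A (fun x hx => by
      have : distTo A hA x = 0 := Nat.le_zero.1 (distTo_le_iff.2 (subset_thicken A 0 hx))
      rw [hneg, this]; simp)
  refine Real.le_sqrt_of_sq_le ?_
  have h2 : Real.log (A.card / 2 ^ n) ≤ -(2 * e ^ 2 / n) := by
    rw [Real.log_le_iff_le_exp (by positivity), div_le_iff₀ (by positivity)]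
    linarith
  rw [le_neg, div_le_iff₀ hnR] at h2
  linarith

/-- Blowing up a set of density `μ` by `√(-n ln μ / 2) + √(-n ln p / 2)` covers all but a fraction
`p` of the cube. -/
lemma one_sub_mul_two_pow_le_card_thicken_floor {n : ℕ} (hn : 0 < n) (A : Finset (Fin n → Bool))
    (hA : A.Nonempty) {p r : ℝ} (hp0 : 0 < p) (hp1 : p ≤ 1)
    (hr : tailRadius n (A.card / 2 ^ n) + tailRadius n p ≤ r) :
    (1 - p) * 2 ^ n ≤ (thicken A ⌊r⌋₊).card := by
  have hnR : (0 : ℝ) < n := by exact_mod_cast hn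
  have havg := cubeAverage_distTo_le hn A hA
  have h := card_le_of_lipschitz hn (fun x => (distTo A hA x : ℝ)) (abs_distTo_sub_le A hA)
    (tailRadius_nonneg n p) (thicken A ⌊r⌋₊)ᶜ (fun x hx => by
      rw [Finset.mem_compl, ← distTo_le_iff (hA := hA), not_le] at hx
      have := (Nat.lt_of_floor_lt hx).le
      linarith)
  have hlog : Real.log p ≤ 0 := Real.log_nonpos hp0.le hp1
  rw [tailRadius, Real.sq_sqrt (by nlinarith),
    show -(2 * (-(n * Real.log p) / 2) / (n : ℝ)) = Real.log p by field_simp,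
    Real.exp_log hp0, Finset.card_compl] at h
  rw [Nat.cast_sub (Finset.card_le_univ _)] at h
  simp only [Fintype.card_fun, Fintype.card_fin, Fintype.card_bool] at h
  push_cast at h
  linarith

/-! ### Risks as cardinalities -/

lemma toReal_toOuterMeasure_uniformOfFintype {n : ℕ} (S : Set (Hypercube n))
    (B : Finset (Fin n → Bool)) (hB : ∀ x, x ∈ B ↔ Hamming.toHamming x ∈ S) :
    ((PMF.uniformOfFintype (Hypercube n)).toOuterMeasure S).toReal = B.card / 2 ^ n := by
  classical
  have hcard : Fintype.card S = B.card := by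
    rw [← Fintype.card_coe]
    exact Fintype.card_congr
      (Hamming.toHamming.subtypeEquiv fun x => hB x).symm
  have hcube : Fintype.card (Hypercube n) = 2 ^ n := by
    rw [← Fintype.card_congr (Hamming.toHamming (β := fun _ : Fin n => Bool))]
    simp
  rw [PMF.toOuterMeasure_uniformOfFintype_apply, hcard, hcube]
  simp

/-- The points of the cube where `h` and `c` differ. -/
noncomputable def errorSet {n : ℕ} {Y : Type*} (h c : Hypercube n → Y) : Finset (Fin n → Bool) :=
  by classical exact {x | h (Hamming.toHamming x) ≠ c (Hamming.toHamming x)}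

lemma mem_errorSet {n : ℕ} {Y : Type*} {h c : Hypercube n → Y} {x : Fin n → Bool} :
    x ∈ errorSet h c ↔ h (Hamming.toHamming x) ≠ c (Hamming.toHamming x) := by
  simp [errorSet]

section

variable {n : ℕ} {Y : Type*} (C H : Set (Hypercube n → Y)) (h c : Hypercube n → Y)

lemma risk_uniformHypercubeProblem :
    (uniformHypercubeProblem n C H).risk h c = (errorSet h c).card / 2 ^ n :=
  toReal_toOuterMeasure_uniformOfFintype _ _ fun _ => mem_errorSet

lemma errorRegionRisk_ofReal {r : ℝ} (hr : 0 ≤ r) :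
    (uniformHypercubeProblem n C H).errorRegionRisk (ENNReal.ofReal r) h c
      = (thicken (errorSet h c) ⌊r⌋₊).card / 2 ^ n := by
  refine toReal_toOuterMeasure_uniformOfFintype _ _ fun x => ?_
  rw [mem_thicken, Set.mem_ofPred_eq]
  have key : ∀ y : Fin n → Bool,
      edist (Hamming.toHamming x : Hypercube n) (Hamming.toHamming y) ≤ ENNReal.ofReal r
        ↔ hammingDist x y ≤ ⌊r⌋₊ := fun y => by
    rw [edist_dist, ENNReal.ofReal_le_ofReal_iff hr, Hamming.dist_eq_hammingDist,
      Nat.le_floor_iff hr]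
    rfl
  constructor
  · rintro ⟨y, hy, hd⟩
    exact ⟨Hamming.toHamming y, (key y).2 hd, mem_errorSet.1 hy⟩
  · rintro ⟨y, hd, hy⟩
    exact ⟨Hamming.ofHamming y, mem_errorSet.2 hy, (key _).1 hd⟩

lemma errorRegionRisk_top (hne : (errorSet h c).Nonempty) :
    (uniformHypercubeProblem n C H).errorRegionRisk ∞ h c = 1 := by
  obtain ⟨y, hy⟩ := hne
  have := toReal_toOuterMeasure_uniformOfFintype
    {x : Hypercube n | ∃ x', edist x x' ≤ ∞ ∧ h x' ≠ c x'} Finset.univ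
    (fun x => by simpa using ⟨_, mem_errorSet.1 hy⟩)
  exact this.trans (by simp)

end

/-! ### Radii, numerical constants and the theorem -/

lemma bitBudget_of_pos {p : ℝ} (n : ℕ) (hp : 0 < p) :
    bitBudget n p = ENNReal.ofReal (tailRadius n p) := by
  rw [bitBudget, if_neg hp.ne', tailRadius]

lemma tailRadius_anti {p q : ℝ} (n : ℕ) (hp : 0 < p) (hpq : p ≤ q) :
    tailRadius n q ≤ tailRadius n p := by
  have := mul_le_mul_of_nonneg_left (Real.log_le_log hp hpq) (Nat.cast_nonneg (α := ℝ) n)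
  exact Real.sqrt_le_sqrt (by linarith)

/-- Amounts to `log 10 ≤ 1.52 ^ 2 = 2.3104`. -/
lemma tailRadius_one_hundredth_le (n : ℕ) : tailRadius n 0.01 ≤ 1.52 * √(n : ℝ) := by
  have hlog : -Real.log 0.01 ≤ 4.6208 := by
    have he : (10 : ℝ) ≤ Real.exp 2.3104 := by
      have h1 := Real.quadratic_le_exp_of_nonneg (by norm_num : (0 : ℝ) ≤ 0.3104)
      have h2 : (2.718 : ℝ) ^ 2 ≤ Real.exp 1 ^ 2 :=
        pow_le_pow_left₀ (by norm_num) (by linarith [Real.exp_one_gt_d9]) 2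
      rw [show (2.3104 : ℝ) = (2 : ℕ) * 1 + 0.3104 by norm_num, Real.exp_add, Real.exp_nat_mul]
      calc (10 : ℝ) ≤ 2.718 ^ 2 * (1 + 0.3104 + 0.3104 ^ 2 / 2) := by norm_num
        _ ≤ _ := by gcongr
    have h10 : Real.log 10 ≤ 2.3104 := (Real.log_le_iff_le_exp (by norm_num)).2 he
    have h100 : Real.log 0.01 = -(2 * Real.log 10) := by
      rw [show (0.01 : ℝ) = (10 ^ 2)⁻¹ by norm_num, Real.log_inv, Real.log_pow]
      norm_num
    linarith
  rw [tailRadius, ← Real.sqrt_sq (by norm_num : (0 : ℝ) ≤ 1.52), ← Real.sqrt_mul (by positivity)]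
  refine Real.sqrt_le_sqrt ?_
  nlinarith [mul_le_mul_of_nonneg_left hlog (Nat.cast_nonneg (α := ℝ) n)]

theorem mainTheorem3 (n : ℕ) {Y : Type*} (C H : Set (Hypercube n → Y))
    (P : ClassificationProblem (Hypercube n) Y) (hP : P = uniformHypercubeProblem n C H)
    (h : Hypercube n → Y) (hh : h ∈ P.hypotheses)
    (c : Hypercube n → Y) (hc : c ∈ P.concepts) :
    (∀ μ : ℝ, P.risk h c = μ → 0 < μ → μ ≤ 1 / 2 →
      (∀ μ' : ℝ, 1 / 2 ≤ μ' → μ' ≤ 1 →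
        μ' ≤ P.errorRegionRisk (bitBudget n μ + bitBudget n (1 - μ')) h c) ∧
      1 / 2 ≤ P.errorRegionRisk (bitBudget n μ) h c) ∧
    (0.01 ≤ P.risk h c →
      0.5 ≤ P.errorRegionRisk (ENNReal.ofReal (1.52 * √(n : ℝ))) h c ∧
      0.99 ≤ P.errorRegionRisk (ENNReal.ofReal (3.04 * √(n : ℝ))) h c) := by
  subst hP
  have hpow : (0 : ℝ) < 2 ^ n := by positivity
  have hne : 0 < (uniformHypercubeProblem n C H).risk h c → (errorSet h c).Nonempty := by
    intro h0
    rw [risk_uniformHypercubeProblem] at h0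
    rw [← Finset.card_pos]
    exact_mod_cast (div_pos_iff_of_pos_right hpow).1 h0
  refine ⟨?_, fun hrisk => ?_⟩
  · rintro μ hμ h0 hhalf
    have hA := hne (hμ ▸ h0)
    rw [risk_uniformHypercubeProblem] at hμ
    -- In dimension zero a nonempty error region has density `1`, which `μ ≤ 1 / 2` excludes.
    have hn : 0 < n := by
      rcases Nat.eq_zero_or_pos n with rfl | hn
      · have : (1 : ℝ) ≤ (errorSet h c).card := by exact_mod_cast hA.card_pos
        rw [pow_zero, div_one] at hμ
        linarith
      · exact hn
    rw [bitBudget_of_pos n h0]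
    refine ⟨fun μ' _ h1 => ?_, ?_⟩
    · rcases h1.eq_or_lt with rfl | hlt
      · rw [sub_self, bitBudget, if_pos rfl, add_top, errorRegionRisk_top _ _ _ _ hA]
      · have hp : 0 < 1 - μ' := by linarith
        rw [bitBudget_of_pos n hp, ← ENNReal.ofReal_add (tailRadius_nonneg _ _)
          (tailRadius_nonneg _ _), errorRegionRisk_ofReal _ _ _ _
            (add_nonneg (tailRadius_nonneg _ _) (tailRadius_nonneg _ _)), le_div_iff₀ hpow]
        have := one_sub_mul_two_pow_le_card_thicken_floor hn (errorSet h c) hA hp (by linarith)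
          (by rw [hμ])
        rwa [sub_sub_cancel] at this
    · rw [errorRegionRisk_ofReal _ _ _ _ (tailRadius_nonneg _ _), le_div_iff₀ hpow]
      have := two_pow_le_two_mul_card_thicken_floor hn (errorSet h c) hA (by rw [hμ])
      linarith
  · have hA := hne (by norm_num at hrisk ⊢; linarith)
    rw [risk_uniformHypercubeProblem] at hrisk
    rw [errorRegionRisk_ofReal _ _ _ _ (by positivity),
      errorRegionRisk_ofReal _ _ _ _ (by positivity), le_div_iff₀ hpow, le_div_iff₀ hpow]
    rcases Nat.eq_zero_or_pos n with rfl | hn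
    · have : ∀ k, (1 : ℝ) ≤ (thicken (errorSet h c) k).card := fun k => by
        exact_mod_cast (hA.mono (subset_thicken _ k)).card_pos
      constructor <;> refine le_trans ?_ (this _) <;> norm_num
    have hr := (tailRadius_anti n (by norm_num) hrisk).trans (tailRadius_one_hundredth_le n)
    constructor
    · have := two_pow_le_two_mul_card_thicken_floor hn (errorSet h c) hA hr
      norm_num at this ⊢
      linarith
    · have := one_sub_mul_two_pow_le_card_thicken_floor hn (errorSet h c) hA (p := 0.01)
        (r := 3.04 * √(n : ℝ)) (by norm_num) (by norm_num)
        (by linarith [tailRadius_one_hundredth_le n])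
      norm_num at this ⊢
      exact this
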